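/- Let $\boldsymbol B=(B_1,B_2)$ be a two-dimensional standard Brownian motion on $[0,\infty)$ with independent components and let $\boldsymbol B^*=(B_1^*,B_2^*)$ be an independent copy of $\boldsymbol B$. Let $\gamma_1,\gamma_2\in[0,2)$ and $a>0$, put $a_1=1$, $a_2=a$, and define $$C(a)=\int_{\mathbb R^2}\mathbb P\Big\{\exists\, t,s_1,s_2\ge 0:\ B_i^*(t)-a_it+\gamma_i\big(B_i(s_i)-a_is_i\big)>x_i\ \text{ for } i=1,2\Big\}\,e^{x_1+ax_2}\,dx_1\,dx_2 .$$ Then the integral converges, and $$C(a)\le \frac{16}{a(2-\gamma_1)(2-\gamma_2)}<\infty .$$ -/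

import Mathlib

open MeasureTheory ProbabilityTheory
open scoped NNReal

namespace BrownianRisk

/-- A two-dimensional standard Brownian motion with independent components, indexed by `[0, ∞)`. -/
structure IsPlanarBrownian {Ω : Type*} [MeasurableSpace Ω] (B : Fin 2 → ℝ≥0 → Ω → ℝ)
    (P : Measure Ω) : Prop where
  brownian : ∀ i, IsBrownianReal (B i) P
  indep : IndepFun (fun ω t ↦ B 0 t ω) (fun ω t ↦ B 1 t ω) P

/-- The event that there are `t ≥ 0` and `s = (s₁, s₂) ≥ 0` such that, componentwise,
`B*(t) - a t + γ (B(s) - a s) > x`, where `B(s) = (B₁(s₁), B₂(s₂))`. -/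
def exceedance {Ω : Type*} (Bstar B : Fin 2 → ℝ≥0 → Ω → ℝ) (γ a x : Fin 2 → ℝ) : Set Ω :=
  {ω | ∃ (t : ℝ≥0) (s : Fin 2 → ℝ≥0), ∀ i : Fin 2,
    Bstar i t ω - a i * (t : ℝ) + γ i * (B i (s i) ω - a i * (s i : ℝ)) > x i}

/-- The integrand of the constant `C(a)`, for the drift vector `(1, a)`. -/
noncomputable def integrandC {Ω : Type*} [MeasurableSpace Ω] (P : Measure Ω)
    (Bstar B : Fin 2 → ℝ≥0 → Ω → ℝ) (γ : Fin 2 → ℝ) (a : ℝ) (x : Fin 2 → ℝ) : ℝ :=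
  P.real (exceedance Bstar B γ ![1, a] x) * Real.exp (x 0 + a * x 1)

/-- The constant `C(a)`, an integral with respect to Lebesgue measure on `ℝ²`. -/
noncomputable def constC {Ω : Type*} [MeasurableSpace Ω] (P : Measure Ω)
    (Bstar B : Fin 2 → ℝ≥0 → Ω → ℝ) (γ : Fin 2 → ℝ) (a : ℝ) : ℝ :=
  ∫ x : Fin 2 → ℝ, integrandC P Bstar B γ a x

end BrownianRisk

/-!
Write `Y_i(t) = B_i(t) - a_i t` and `Y*_i(t) = B*_i(t) - a_i t`, with `a_1 = 1` and `a_2 = a`. If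
the levels `x` are exceeded in the sense of `exceedance`, then
`exp (a_i x_i) < M*_i M_i` for both `i`, where `M*_i = sup_t exp (a_i Y*_i(t))` and
`M_i = sup_s exp (a_i γ_i Y_i(s))`. The stated constant leaves room for letting the two coordinates
of `B*` be maximized at different times. For fixed `K` the integral of `exp (a_i x_i)` over
the `x_i` with `exp (a_i x_i) < K` is `K / a_i`, so Tonelli's theorem bounds `C(a)` by
`E[M*_1 M*_2 M_1 M_2] / a` (`lintegral_exceedanceOn_le`), and the expectation factorizes because the
four suprema are independent.

It remains to see that `E[sup_t exp (c (X_t - b t))] ≤ 2 b / (2 b - c)` for a Brownian motion `X`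
and `0 ≤ c < 2 b` (`lintegral_expSup_le`). The exponential martingale
`exp (2 b (X_t - b t))` has mean `1`, so by the maximal inequality its supremum is at least `l` with
probability at most `1 / l` (`measure_exists_le_expDrift_le`). Hence the tail of
`sup_t exp (c (X_t - b t))` at `u` is at most `u ^ (-2 b / c)`, and integrating the tail gives the
bound (`lintegral_le_of_tail`). With `c = a_i = b` the value is `2`, and with `c = a_i γ_i`,
`b = a_i` it is `2 / (2 - γ_i)`, which accounts for `16 / (a (2 - γ_1) (2 - γ_2))`.

All suprema are taken over a dense sequence of times, which makes them measurable; continuity of the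
paths shows that the event `exceedance` does not notice the difference
(`mem_exceedance_iff_of_denseRange`). Suprema and expectations take values in `ℝ≥0∞`.
-/

open scoped ENNReal

namespace BrownianRisk

/-! ### Integrals of exponential weights over the levels -/

lemma lintegral_exp_mul_lt_le {a : ℝ} (ha : 0 < a) (K : ℝ≥0∞) :
    ∫⁻ x in {x : ℝ | ENNReal.ofReal (Real.exp (a * x)) < K}, ENNReal.ofReal (Real.exp (a * x))
      ≤ K / ENNReal.ofReal a := by
  rcases eq_or_ne K ∞ with rfl | hK
  · simp [ENNReal.top_div]
  rcases eq_or_ne K 0 with rfl | hK0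
  · simp
  have hpos : 0 < K.toReal := ENNReal.toReal_pos hK0 hK
  have hsub : {x : ℝ | ENNReal.ofReal (Real.exp (a * x)) < K}
      ⊆ Set.Iic (Real.log K.toReal / a) := by
    intro x hx
    have h1 : Real.exp (a * x) < K.toReal :=
      (ENNReal.ofReal_lt_iff_lt_toReal (Real.exp_nonneg _) hK).1 hx
    have h2 := (Real.lt_log_iff_exp_lt hpos).2 h1
    rw [Set.mem_Iic, le_div_iff₀ ha]
    linarith
  refine (lintegral_mono_set hsub).trans_eq ?_
  rw [← ofReal_integral_eq_lintegral_ofReal (integrableOn_exp_mul_Iic ha _)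
    (ae_of_all _ fun _ ↦ Real.exp_nonneg _), integral_exp_mul_Iic ha, mul_div_cancel₀ _ ha.ne',
    Real.exp_log hpos, ENNReal.ofReal_div_of_pos ha, ENNReal.ofReal_toReal hK]

lemma lintegral_fin_two_mul {f g : ℝ → ℝ≥0∞} (hf : Measurable f) (hg : Measurable g) :
    ∫⁻ x : Fin 2 → ℝ, f (x 0) * g (x 1) = (∫⁻ x, f x) * ∫⁻ x, g x := by
  have h := (volume_preserving_finTwoArrow ℝ).lintegral_comp
    (f := fun p : ℝ × ℝ ↦ f p.1 * g p.2) (by fun_prop)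
  rw [Measure.volume_eq_prod, lintegral_prod_mul hf.aemeasurable hg.aemeasurable] at h
  simpa using h

/-! ### Exceedance along a dense sequence of times -/

/-- The condition defining `exceedance` for two pairs of paths, with all times restricted to the
range of `q`; the paths enter through their values `w i n` and `w' i n` at the times `q n`. -/
def exceedanceOn (q : ℕ → ℝ≥0) (w w' : Fin 2 → ℕ → ℝ) (γ a x : Fin 2 → ℝ) : Prop :=
  ∃ (n : ℕ) (m : Fin 2 → ℕ), ∀ i : Fin 2,
    w i n - a i * q n + γ i * (w' i (m i) - a i * q (m i)) > x i

lemma mem_exceedance_iff_of_denseRange {Ω : Type*} {q : ℕ → ℝ≥0} (hq : DenseRange q)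
    {Bstar B : Fin 2 → ℝ≥0 → Ω → ℝ} {ω : Ω} (hBstar : ∀ i, Continuous fun t ↦ Bstar i t ω)
    (hB : ∀ i, Continuous fun t ↦ B i t ω) (γ a x : Fin 2 → ℝ) :
    ω ∈ exceedance Bstar B γ a x ↔
      exceedanceOn q (fun i n ↦ Bstar i (q n) ω) (fun i n ↦ B i (q n) ω) γ a x := by
  constructor
  · rintro ⟨t, s, h⟩
    have hopen : IsOpen {p : ℝ≥0 × (Fin 2 → ℝ≥0) | ∀ i : Fin 2,
        x i < Bstar i p.1 ω - a i * (p.1 : ℝ) + γ i * (B i (p.2 i) ω - a i * (p.2 i : ℝ))} := by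
      simp only [Set.ofPred_forall]
      refine isOpen_iInter_of_finite fun i ↦ isOpen_lt continuous_const ?_
      have h1 := hBstar i
      have h2 := hB i
      fun_prop
    -- the inequalities are strict, so they persist at nearby times
    have hdense : DenseRange (Prod.map q (fun m : Fin 2 → ℕ ↦ fun i ↦ q (m i))) :=
      hq.prodMap (DenseRange.piMap fun _ ↦ hq)
    obtain ⟨⟨n, m⟩, hnm⟩ := hdense.exists_mem_open hopen ⟨(t, s), h⟩
    exact ⟨n, m, hnm⟩
  · rintro ⟨n, m, h⟩
    exact ⟨q n, fun i ↦ q (m i), h⟩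

/-! ### Exponentials of drifted paths -/

/-- The exponential `exp (c (y - b t))` of `c` times the position at time `t`, corrected by the
drift `-b`, of a path that takes the value `y` at `t`. -/
noncomputable def expDrift (c b : ℝ) (t : ℝ≥0) (y : ℝ) : ℝ≥0∞ :=
  ENNReal.ofReal (Real.exp (c * (y - b * t)))

@[fun_prop]
lemma measurable_expDrift (c b : ℝ) (t : ℝ≥0) : Measurable (expDrift c b t) := by
  unfold expDrift; fun_prop

/-- The supremum of `exp (c (w t - b t))` over the times `t` in the range of `q`. -/
noncomputable def expSup (q : ℕ → ℝ≥0) (c b : ℝ) (w : ℝ≥0 → ℝ) : ℝ≥0∞ :=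
  ⨆ n, expDrift c b (q n) (w (q n))

@[fun_prop]
lemma measurable_expSup (q : ℕ → ℝ≥0) (c b : ℝ) : Measurable (expSup q c b) :=
  Measurable.iSup fun n ↦ (measurable_expDrift c b (q n)).comp (measurable_pi_apply _)

lemma ofReal_exp_lt_expSup_mul {q : ℕ → ℝ≥0} {w w' : ℝ≥0 → ℝ} {γ a x : ℝ} (ha : 0 < a) {n m : ℕ}
    (h : w (q n) - a * q n + γ * (w' (q m) - a * q m) > x) :
    ENNReal.ofReal (Real.exp (a * x)) < expSup q a a w * expSup q (a * γ) a w' := by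
  calc ENNReal.ofReal (Real.exp (a * x))
      < ENNReal.ofReal (Real.exp (a * (w (q n) - a * q n + γ * (w' (q m) - a * q m)))) := by
        rw [ENNReal.ofReal_lt_ofReal_iff (Real.exp_pos _), Real.exp_lt_exp]
        exact mul_lt_mul_of_pos_left h ha
    _ = expDrift a a (q n) (w (q n)) * expDrift (a * γ) a (q m) (w' (q m)) := by
        rw [expDrift, expDrift, ← ENNReal.ofReal_mul (Real.exp_nonneg _), ← Real.exp_add]
        ring_nf
    _ ≤ _ := mul_le_mul' (le_iSup (fun n ↦ expDrift a a (q n) (w (q n))) n)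
        (le_iSup (fun n ↦ expDrift (a * γ) a (q n) (w' (q n))) m)

/-- The weight of the set of levels exceeded by a pair of fixed paths. The bound only uses that each
coordinate is exceeded separately. -/
lemma lintegral_exceedanceOn_le (q : ℕ → ℝ≥0) (w w' : Fin 2 → ℝ≥0 → ℝ) (γ : Fin 2 → ℝ)
    {a : Fin 2 → ℝ} (ha : ∀ i, 0 < a i) :
    ∫⁻ x in {x : Fin 2 → ℝ | exceedanceOn q (fun i n ↦ w i (q n)) (fun i n ↦ w' i (q n)) γ a x},
        ENNReal.ofReal (Real.exp (a 0 * x 0 + a 1 * x 1))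
      ≤ (expSup q (a 0) (a 0) (w 0) * expSup q (a 1) (a 1) (w 1))
        * (expSup q (a 0 * γ 0) (a 0) (w' 0) * expSup q (a 1 * γ 1) (a 1) (w' 1))
        / ENNReal.ofReal (a 0 * a 1) := by
  set K : Fin 2 → ℝ≥0∞ := fun i ↦ expSup q (a i) (a i) (w i) * expSup q (a i * γ i) (a i) (w' i)
    with hK
  set S : Fin 2 → Set ℝ := fun i ↦ {x | ENNReal.ofReal (Real.exp (a i * x)) < K i} with hS
  have hSm i : MeasurableSet (S i) := measurableSet_lt (by fun_prop) measurable_const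
  have hfm i : Measurable ((S i).indicator fun x ↦ ENNReal.ofReal (Real.exp (a i * x))) :=
    Measurable.indicator (by fun_prop) (hSm i)
  have hi i : ∫⁻ x, (S i).indicator (fun x ↦ ENNReal.ofReal (Real.exp (a i * x))) x
      ≤ K i / ENNReal.ofReal (a i) := by
    rw [lintegral_indicator (hSm i)]
    exact lintegral_exp_mul_lt_le (ha i) (K i)
  calc _ ≤ ∫⁻ x : Fin 2 → ℝ,
          (S 0).indicator (fun x ↦ ENNReal.ofReal (Real.exp (a 0 * x))) (x 0)
            * (S 1).indicator (fun x ↦ ENNReal.ofReal (Real.exp (a 1 * x))) (x 1) := by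
        have hsub : {x : Fin 2 → ℝ | exceedanceOn q (fun i n ↦ w i (q n))
            (fun i n ↦ w' i (q n)) γ a x} ⊆ {x | x 0 ∈ S 0 ∧ x 1 ∈ S 1} := by
          rintro x ⟨n, m, h⟩
          exact ⟨ofReal_exp_lt_expSup_mul (ha 0) (h 0), ofReal_exp_lt_expSup_mul (ha 1) (h 1)⟩
        have hm : MeasurableSet {x : Fin 2 → ℝ | x 0 ∈ S 0 ∧ x 1 ∈ S 1} :=
          ((hSm 0).preimage (measurable_pi_apply 0)).inter ((hSm 1).preimage (measurable_pi_apply 1))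
        refine (lintegral_mono_set hsub).trans_eq ?_
        rw [← lintegral_indicator hm]
        refine lintegral_congr fun x ↦ ?_
        by_cases h0 : x 0 ∈ S 0 <;> by_cases h1 : x 1 ∈ S 1 <;>
          simp [h0, h1, Real.exp_add, ENNReal.ofReal_mul (Real.exp_nonneg _)]
    _ ≤ K 0 / ENNReal.ofReal (a 0) * (K 1 / ENNReal.ofReal (a 1)) := by
        rw [lintegral_fin_two_mul (hfm 0) (hfm 1)]
        exact mul_le_mul' (hi 0) (hi 1)
    _ = _ := by
        rw [ENNReal.ofReal_mul (ha 0).le, div_eq_mul_inv, div_eq_mul_inv, div_eq_mul_inv,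
          ENNReal.mul_inv (by simp [ha 0]) (by simp)]
        simp only [hK]
        ring

variable {Ω : Type*} [MeasurableSpace Ω] {P : Measure Ω} {X : ℝ≥0 → Ω → ℝ}

/-! ### The maximal inequality for the exponential martingale -/

lemma lintegral_expDrift (hX : IsPreBrownianReal X P) (b : ℝ) (t : ℝ≥0) :
    ∫⁻ ω, expDrift (2 * b) b t (X t ω) ∂P = 1 := by
  have hlaw := hX.hasLaw_eval t
  rw [hlaw.lintegral_comp (f := expDrift (2 * b) b t) (by fun_prop)]
  have h1 : ∀ y : ℝ, Real.exp (2 * b * (y - b * t))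
      = Real.exp (-(2 * b * (b * t))) * Real.exp (2 * b * y) := fun y ↦ by
    rw [← Real.exp_add]; ring_nf
  have hint := (integrable_exp_mul_gaussianReal (μ := 0) (v := t) (2 * b)).const_mul
    (Real.exp (-(2 * b * (b * t))))
  have hm : ∫ y, Real.exp (2 * b * y) ∂(gaussianReal 0 t) = Real.exp (t * (2 * b) ^ 2 / 2) := by
    have := congrFun (mgf_id_gaussianReal (μ := 0) (v := t)) (2 * b)
    simpa [mgf] using this
  simp only [expDrift, h1]
  rw [← ofReal_integral_eq_lintegral_ofReal hint (ae_of_all _ fun _ ↦ by positivity),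
    integral_const_mul, hm, ← Real.exp_add]
  ring_nf
  simp

/-- The martingale property of `exp (2 b (X t - b t))`, tested against a function of the path up to
time `s`. -/
lemma lintegral_mul_expDrift (hX : IsPreBrownianReal X P) (hm : ∀ t, Measurable (X t))
    (b : ℝ) {s t : ℝ≥0} (hst : s ≤ t) {g : (Set.Iic s → ℝ) → ℝ≥0∞} (hg : Measurable g) :
    ∫⁻ ω, g (fun u ↦ X u ω) * expDrift (2 * b) b t (X t ω) ∂P
      = ∫⁻ ω, g (fun u ↦ X u ω) * expDrift (2 * b) b s (X s ω) ∂P := by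
  obtain ⟨r, rfl⟩ := exists_add_of_le hst
  have hmul : ∀ ω, expDrift (2 * b) b (s + r) (X (s + r) ω)
      = expDrift (2 * b) b s (X s ω) * expDrift (2 * b) b r (X (s + r) ω - X s ω) := fun ω ↦ by
    rw [expDrift, expDrift, expDrift, ← ENNReal.ofReal_mul (Real.exp_nonneg _), ← Real.exp_add]
    push_cast
    ring_nf
  have hind : IndepFun
      (fun ω ↦ g (fun u ↦ X u ω) * expDrift (2 * b) b s (X s ω))
      (fun ω ↦ expDrift (2 * b) b r (X (s + r) ω - X s ω)) P :=
    (hX.indepFun_shift s).symm.comp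
      (φ := fun w : Set.Iic s → ℝ ↦ g w * expDrift (2 * b) b s (w ⟨s, Set.mem_Iic.2 le_rfl⟩))
      (ψ := fun w : ℝ≥0 → ℝ ↦ expDrift (2 * b) b r (w r)) (by fun_prop) (by fun_prop)
  simp only [hmul, ← mul_assoc]
  rw [lintegral_mul_eq_lintegral_mul_lintegral_of_indepFun'' _ _ hind,
    lintegral_expDrift (hX.shift s) b r, mul_one]
  · fun_prop
  · fun_prop

/-- The maximal inequality for the exponential martingale on a finite set of times. The second
summand, the mass left on the event that the level `l` is not reached, carries the induction on the
largest time: it pays for the paths that reach `l` at the time that is added. -/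
lemma mul_measure_exists_le_add_lintegral_le (hX : IsPreBrownianReal X P)
    (hm : ∀ t, Measurable (X t)) (b : ℝ) (l : ℝ≥0∞) (I : Finset ℝ≥0) :
    ∀ t : ℝ≥0, (∀ s ∈ I, s ≤ t) →
      l * P {ω | ∃ s ∈ I, l ≤ expDrift (2 * b) b s (X s ω)}
        + ∫⁻ ω in {ω | ∃ s ∈ I, l ≤ expDrift (2 * b) b s (X s ω)}ᶜ,
            expDrift (2 * b) b t (X t ω) ∂P ≤ 1 := by
  induction I using Finset.induction_on_max with
  | empty => intro t _; simp [lintegral_expDrift hX]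
  | insert m I hI ih =>
    intro t ht
    have hmt : m ≤ t := ht m (Finset.mem_insert_self _ _)
    set A : Set Ω := {ω | ∃ s ∈ I, l ≤ expDrift (2 * b) b s (X s ω)} with hA
    set D : Set Ω := {ω | l ≤ expDrift (2 * b) b m (X m ω)} with hD
    have hDm : MeasurableSet D := measurableSet_le measurable_const (by fun_prop)
    have hAm : MeasurableSet A := by
      have : A = ⋃ s ∈ I, {ω | l ≤ expDrift (2 * b) b s (X s ω)} := by ext; simp [hA]
      rw [this]
      exact Finset.measurableSet_biUnion _ fun s _ ↦ measurableSet_le measurable_const (by fun_prop)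
    have hAD : {ω | ∃ s ∈ insert m I, l ≤ expDrift (2 * b) b s (X s ω)} = A ∪ (Aᶜ ∩ D) := by
      ext ω
      simp only [Finset.mem_insert, exists_eq_or_imp, Set.mem_ofPred_eq, Set.mem_union,
        Set.mem_inter_iff, Set.mem_compl_iff, hA, hD]
      by_cases h : ∃ s ∈ I, l ≤ expDrift (2 * b) b s (X s ω) <;> simp [h]
    have hADc : (A ∪ (Aᶜ ∩ D))ᶜ = Aᶜ ∩ Dᶜ := by
      ext ω
      simp only [Set.mem_union, Set.mem_inter_iff, Set.mem_compl_iff]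
      tauto
    -- on the event that the level is not reached up to time `m`, time `t` may be replaced by `m`
    have hstep : ∫⁻ ω in Aᶜ ∩ Dᶜ, expDrift (2 * b) b t (X t ω) ∂P
        = ∫⁻ ω in Aᶜ ∩ Dᶜ, expDrift (2 * b) b m (X m ω) ∂P := by
      let G : Set (Set.Iic m → ℝ) :=
        {w | ∀ s : Set.Iic m, s.1 ∈ insert m I → expDrift (2 * b) b s (w s) < l}
      have hG : MeasurableSet G := by
        have : G = ⋂ s ∈ {s : Set.Iic m | s.1 ∈ insert m I},
            {w | expDrift (2 * b) b s (w s) < l} := by ext; simp [G]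
        rw [this]
        refine MeasurableSet.biInter ?_ fun s _ ↦ measurableSet_lt (by fun_prop) measurable_const
        exact ((insert m I).countable_toSet.preimage Subtype.val_injective)
      have hGA : Aᶜ ∩ Dᶜ = (fun ω (u : Set.Iic m) ↦ X u ω) ⁻¹' G := by
        ext ω
        simp only [Set.mem_inter_iff, Set.mem_compl_iff, Set.mem_preimage, G, hA, hD,
          Set.mem_ofPred_eq, Finset.mem_insert, not_exists, not_and, not_le, Subtype.forall,
          Set.mem_Iic]
        constructor
        · rintro ⟨h1, h2⟩ s _ (rfl | hs)
          · exact h2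
          · exact h1 s hs
        · intro h
          exact ⟨fun s hs ↦ h s (hI s hs).le (Or.inr hs), h m le_rfl (Or.inl rfl)⟩
      have key := lintegral_mul_expDrift hX hm b hmt (g := G.indicator 1)
        (measurable_one.indicator hG)
      rw [hGA, ← lintegral_indicator, ← lintegral_indicator]
      · convert key using 3 with ω ω <;>
        · by_cases h : (fun u : Set.Iic m ↦ X u ω) ∈ G <;> simp [Set.indicator, h]
      all_goals exact hG.preimage (by fun_prop)
    rw [hAD, hADc, hstep]
    have ih' := ih m fun s hs ↦ (hI s hs).le
    refine le_trans ?_ ih'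
    have h1 : l * P (Aᶜ ∩ D) ≤ ∫⁻ ω in Aᶜ ∩ D, expDrift (2 * b) b m (X m ω) ∂P := by
      rw [← setLIntegral_const]
      exact setLIntegral_mono' (hAm.compl.inter hDm) fun ω hω ↦ hω.2
    calc l * P (A ∪ (Aᶜ ∩ D)) + ∫⁻ ω in Aᶜ ∩ Dᶜ, expDrift (2 * b) b m (X m ω) ∂P
        ≤ l * (P A + P (Aᶜ ∩ D)) + ∫⁻ ω in Aᶜ ∩ Dᶜ, expDrift (2 * b) b m (X m ω) ∂P := by
          gcongr
          exact measure_union_le _ _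
      _ ≤ l * P A + ((∫⁻ ω in Aᶜ ∩ D, expDrift (2 * b) b m (X m ω) ∂P)
            + ∫⁻ ω in Aᶜ ∩ Dᶜ, expDrift (2 * b) b m (X m ω) ∂P) := by
          rw [mul_add, add_assoc]
          gcongr
      _ = l * P A + ∫⁻ ω in Aᶜ, expDrift (2 * b) b m (X m ω) ∂P := by
          rw [← Set.sdiff_eq, lintegral_inter_add_sdiff _ _ hDm]

/-- The maximal inequality for the exponential martingale along a sequence of times, which need not
be monotone. -/
lemma measure_exists_le_expDrift_le (hX : IsPreBrownianReal X P) (q : ℕ → ℝ≥0) (b : ℝ) {l : ℝ}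
    (hl : 0 < l) :
    P {ω | ∃ n, ENNReal.ofReal l ≤ expDrift (2 * b) b (q n) (X (q n) ω)}
      ≤ ENNReal.ofReal l⁻¹ := by
  wlog hm : ∀ t, Measurable (X t) generalizing X
  · -- only countably many times occur, so `X` may be replaced by a measurable modification
    have hX' := hX.congr fun t ↦ (hX.aemeasurable t).ae_eq_mk
    refine le_trans (measure_mono_ae ?_) (this hX' fun t ↦ (hX.aemeasurable t).measurable_mk)
    have : ∀ᵐ ω ∂P, ∀ n, X (q n) ω = (hX.aemeasurable (q n)).mk (X (q n)) ω :=
      ae_all_iff.2 fun n ↦ (hX.aemeasurable (q n)).ae_eq_mk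
    filter_upwards [this] with ω hω
    rintro ⟨n, hn⟩
    exact ⟨n, by rwa [← hω n]⟩
  have hU : {ω | ∃ n, ENNReal.ofReal l ≤ expDrift (2 * b) b (q n) (X (q n) ω)}
      = ⋃ N : ℕ, {ω | ∃ s ∈ (Finset.range N).image q,
          ENNReal.ofReal l ≤ expDrift (2 * b) b s (X s ω)} := by
    ext ω
    simp only [Set.mem_ofPred_eq, Finset.mem_image, Finset.mem_range, Set.mem_iUnion]
    constructor
    · rintro ⟨n, hn⟩
      exact ⟨n + 1, q n, ⟨n, by omega, rfl⟩, hn⟩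
    · rintro ⟨_, _, ⟨n, _, rfl⟩, h⟩
      exact ⟨n, h⟩
  rw [hU, Monotone.measure_iUnion]
  · refine iSup_le fun N ↦ ?_
    have := mul_measure_exists_le_add_lintegral_le hX hm b (ENNReal.ofReal l)
      ((Finset.range N).image q) (((Finset.range N).image q).sup id)
      fun s hs ↦ Finset.le_sup (f := id) hs
    rw [ENNReal.ofReal_inv_of_pos hl, ← one_div, ENNReal.le_div_iff_mul_le, mul_comm]
    · exact le_self_add.trans this
    · simp [hl]
    · simp
  · intro N M h ω
    rintro ⟨s, hs, hs'⟩
    exact ⟨s, Finset.image_subset_image (Finset.range_mono h) hs, hs'⟩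

/-! ### Moments of the suprema -/

/-- The layer-cake formula, with the tail bounded by `1` on `(0, 1]` and by `u ^ (-r)` beyond. -/
lemma lintegral_le_of_tail {f : Ω → ℝ≥0∞} [IsProbabilityMeasure P] (hf : AEMeasurable f P) {r : ℝ}
    (hr : 1 < r)
    (h : ∀ u : ℝ, 0 < u → P {ω | ENNReal.ofReal u < f ω} ≤ ENNReal.ofReal (u ^ (-r))) :
    ∫⁻ ω, f ω ∂P ≤ ENNReal.ofReal (r / (r - 1)) := by
  have hfin : ∀ᵐ ω ∂P, f ω ≠ ∞ := by
    have hlim : Filter.Tendsto (fun u : ℝ ↦ ENNReal.ofReal (u ^ (-r))) Filter.atTop (nhds 0) := by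
      simpa using ENNReal.tendsto_ofReal (tendsto_rpow_neg_atTop (by linarith : 0 < r))
    have : P {ω | f ω = ∞} ≤ 0 := by
      refine ge_of_tendsto hlim ?_
      filter_upwards [Filter.eventually_gt_atTop 0] with u hu
      refine le_trans (measure_mono fun ω hω ↦ ?_) (h u hu)
      rw [Set.mem_ofPred_eq] at hω ⊢
      simp [hω]
    simpa [ae_iff] using this
  have heq : ∫⁻ ω, f ω ∂P = ∫⁻ ω, ENNReal.ofReal (f ω).toReal ∂P :=
    lintegral_congr_ae (hfin.mono fun ω hω ↦ (ENNReal.ofReal_toReal hω).symm)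
  rw [heq, lintegral_eq_lintegral_meas_lt P (ae_of_all _ fun _ ↦ ENNReal.toReal_nonneg)
    hf.ennreal_toReal, ← Set.Ioc_union_Ioi_eq_Ioi (zero_le_one (α := ℝ)),
    lintegral_union measurableSet_Ioi (Set.Ioc_disjoint_Ioi le_rfl)]
  have h1 : ∫⁻ t in Set.Ioc (0 : ℝ) 1, P {ω | t < (f ω).toReal} ≤ 1 := by
    calc ∫⁻ t in Set.Ioc (0 : ℝ) 1, P {ω | t < (f ω).toReal}
        ≤ ∫⁻ _ in Set.Ioc (0 : ℝ) 1, 1 := lintegral_mono fun _ ↦ prob_le_one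
      _ = 1 := by simp
  have h2 : ∫⁻ t in Set.Ioi (1 : ℝ), P {ω | t < (f ω).toReal} ≤ ENNReal.ofReal (1 / (r - 1)) := by
    calc ∫⁻ t in Set.Ioi (1 : ℝ), P {ω | t < (f ω).toReal}
        ≤ ∫⁻ t in Set.Ioi (1 : ℝ), ENNReal.ofReal (t ^ (-r)) := by
          refine setLIntegral_mono' measurableSet_Ioi fun t ht ↦ ?_
          have ht0 : 0 < t := zero_lt_one.trans ht
          refine le_trans (measure_mono fun ω hω ↦ ?_) (h t ht0)
          exact (ENNReal.ofReal_lt_ofReal_iff_of_nonneg ht0.le).2 hω |>.trans_le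
            ENNReal.ofReal_toReal_le
      _ = ENNReal.ofReal (∫ t in Set.Ioi (1 : ℝ), t ^ (-r)) := by
          rw [ofReal_integral_eq_lintegral_ofReal
            (integrableOn_Ioi_rpow_of_lt (by linarith) zero_lt_one)]
          filter_upwards [ae_restrict_mem measurableSet_Ioi] with t ht
          exact Real.rpow_nonneg (zero_lt_one.trans ht).le _
      _ = ENNReal.ofReal (1 / (r - 1)) := by
          rw [integral_Ioi_rpow_of_lt (by linarith) zero_lt_one, Real.one_rpow]
          congr 1
          rw [neg_div, ← div_neg]
          ring_nf
  refine (add_le_add h1 h2).trans_eq ?_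
  rw [← ENNReal.ofReal_one, ← ENNReal.ofReal_add zero_le_one (by
    have : 0 < r - 1 := by linarith
    positivity)]
  congr 1
  have : r - 1 ≠ 0 := by linarith
  field_simp
  ring

lemma aemeasurable_expSup (hX : IsPreBrownianReal X P) (q : ℕ → ℝ≥0) (c b : ℝ) :
    AEMeasurable (fun ω ↦ expSup q c b fun t ↦ X t ω) P :=
  AEMeasurable.iSup fun n ↦ (measurable_expDrift c b (q n)).comp_aemeasurable (hX.aemeasurable _)

lemma lintegral_expSup_le [IsProbabilityMeasure P] (hX : IsPreBrownianReal X P) (q : ℕ → ℝ≥0)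
    {c b : ℝ} (hc : 0 ≤ c) (hcb : c < 2 * b) :
    ∫⁻ ω, expSup q c b (fun t ↦ X t ω) ∂P ≤ ENNReal.ofReal (2 * b / (2 * b - c)) := by
  rcases hc.eq_or_lt with rfl | hc
  · -- the exponent `2 * b / c` below has no meaning here, but the supremum is constantly `1`
    simp [expSup, expDrift, div_self hcb.ne']
  have hr : 1 < 2 * b / c := (one_lt_div hc).2 hcb
  refine (lintegral_le_of_tail (aemeasurable_expSup hX q c b) hr fun u hu ↦ ?_).trans_eq ?_
  · rw [Real.rpow_neg hu.le]
    refine le_trans (measure_mono fun ω hω ↦ ?_)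
      (measure_exists_le_expDrift_le hX q b (Real.rpow_pos_of_pos hu (2 * b / c)))
    -- raising `exp (c y)` to the power `2 b / c` gives the martingale
    obtain ⟨n, hn⟩ : ∃ n, ENNReal.ofReal u < expDrift c b (q n) (X (q n) ω) := by
      rw [Set.mem_ofPred_eq, expSup, lt_iSup_iff] at hω
      exact hω
    refine ⟨n, ENNReal.ofReal_le_ofReal ?_⟩
    have hn' := ((ENNReal.ofReal_lt_ofReal_iff_of_nonneg hu.le).1 hn).le
    calc u ^ (2 * b / c) ≤ Real.exp (c * (X (q n) ω - b * q n)) ^ (2 * b / c) := by gcongr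
      _ = Real.exp (2 * b * (X (q n) ω - b * q n)) := by
        rw [← Real.exp_mul]
        congr 1
        field_simp
  · congr 1
    have : 2 * b - c ≠ 0 := by linarith
    field_simp

lemma IsPlanarBrownian.lintegral_expSup_mul_le [IsProbabilityMeasure P] {B : Fin 2 → ℝ≥0 → Ω → ℝ}
    (hB : IsPlanarBrownian B P) (q : ℕ → ℝ≥0) {c b : Fin 2 → ℝ} (hc : ∀ i, 0 ≤ c i)
    (hcb : ∀ i, c i < 2 * b i) :
    ∫⁻ ω, expSup q (c 0) (b 0) (fun t ↦ B 0 t ω) * expSup q (c 1) (b 1) (fun t ↦ B 1 t ω) ∂P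
      ≤ ENNReal.ofReal (2 * b 0 / (2 * b 0 - c 0)) * ENNReal.ofReal (2 * b 1 / (2 * b 1 - c 1)) := by
  have hX i := (hB.brownian i).toIsPreBrownianReal
  rw [lintegral_mul_eq_lintegral_mul_lintegral_of_indepFun''
    (f := fun ω ↦ expSup q (c 0) (b 0) (fun t ↦ B 0 t ω))
    (g := fun ω ↦ expSup q (c 1) (b 1) (fun t ↦ B 1 t ω))
    (aemeasurable_expSup (hX 0) q _ _) (aemeasurable_expSup (hX 1) q _ _)
    (hB.indep.comp (φ := expSup q (c 0) (b 0)) (ψ := expSup q (c 1) (b 1))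
      (by fun_prop) (by fun_prop))]
  exact mul_le_mul' (lintegral_expSup_le (hX 0) q (hc 0) (hcb 0))
    (lintegral_expSup_le (hX 1) q (hc 1) (hcb 1))

/-! ### The constant `C(a)` -/

lemma measurableSet_exceedanceOn (q : ℕ → ℝ≥0) {Y Y' : Fin 2 → ℕ → Ω → ℝ}
    (hY : ∀ i n, Measurable (Y i n)) (hY' : ∀ i n, Measurable (Y' i n)) (γ a : Fin 2 → ℝ) :
    MeasurableSet {p : (Fin 2 → ℝ) × Ω |
      exceedanceOn q (fun i n ↦ Y i n p.2) (fun i n ↦ Y' i n p.2) γ a p.1} := by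
  simp only [exceedanceOn, Set.ofPred_exists, Set.ofPred_forall]
  refine MeasurableSet.iUnion fun n ↦ MeasurableSet.iUnion fun m ↦ MeasurableSet.iInter fun i ↦ ?_
  have h1 := hY i n
  have h2 := hY' i (m i)
  exact measurableSet_lt (by fun_prop) (by fun_prop)

/-- The events `exceedance` depend jointly measurably on the levels and on the outcome, up to null
sets: the Brownian motions are only almost everywhere measurable with almost surely continuous
paths, so they are replaced by measurable modifications along a dense sequence of times. -/
lemma exists_measurableSet_exceedance {q : ℕ → ℝ≥0} (hq : DenseRange q)
    {B Bstar : Fin 2 → ℝ≥0 → Ω → ℝ} (hB : ∀ i, IsBrownianReal (B i) P)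
    (hBstar : ∀ i, IsBrownianReal (Bstar i) P) (γ a : Fin 2 → ℝ) :
    ∃ E : Set ((Fin 2 → ℝ) × Ω), MeasurableSet E ∧
      (∀ x, P (exceedance Bstar B γ a x) = P (Prod.mk x ⁻¹' E)) ∧
      ∀ᵐ ω ∂P, ∀ x, (x, ω) ∈ E ↔
        exceedanceOn q (fun i n ↦ Bstar i (q n) ω) (fun i n ↦ B i (q n) ω) γ a x := by
  have hX i := (hB i).toIsPreBrownianReal
  have hXs i := (hBstar i).toIsPreBrownianReal
  let Y : Fin 2 → ℕ → Ω → ℝ := fun i n ↦ ((hXs i).aemeasurable (q n)).mk (Bstar i (q n))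
  let Y' : Fin 2 → ℕ → Ω → ℝ := fun i n ↦ ((hX i).aemeasurable (q n)).mk (B i (q n))
  have hYae : ∀ᵐ ω ∂P, (fun i n ↦ Y i n ω) = (fun i n ↦ Bstar i (q n) ω)
      ∧ (fun i n ↦ Y' i n ω) = (fun i n ↦ B i (q n) ω) := by
    have h1 : ∀ᵐ ω ∂P, ∀ i n, Bstar i (q n) ω = Y i n ω :=
      ae_all_iff.2 fun i ↦ ae_all_iff.2 fun n ↦ ((hXs i).aemeasurable (q n)).ae_eq_mk
    have h2 : ∀ᵐ ω ∂P, ∀ i n, B i (q n) ω = Y' i n ω :=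
      ae_all_iff.2 fun i ↦ ae_all_iff.2 fun n ↦ ((hX i).aemeasurable (q n)).ae_eq_mk
    filter_upwards [h1, h2] with ω h1 h2
    exact ⟨funext fun i ↦ funext fun n ↦ (h1 i n).symm, funext fun i ↦ funext fun n ↦ (h2 i n).symm⟩
  let E : Set ((Fin 2 → ℝ) × Ω) := {p | exceedanceOn q (fun i n ↦ Y i n p.2)
    (fun i n ↦ Y' i n p.2) γ a p.1}
  have hEm : MeasurableSet E := measurableSet_exceedanceOn q
    (fun i n ↦ AEMeasurable.measurable_mk _) (fun i n ↦ AEMeasurable.measurable_mk _) γ _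
  refine ⟨E, hEm, fun x ↦ ?_, ?_⟩
  · refine measure_congr ?_
    have hc : ∀ᵐ ω ∂P, ∀ i, Continuous (B i · ω) := ae_all_iff.2 fun i ↦ (hB i).cont
    have hcs : ∀ᵐ ω ∂P, ∀ i, Continuous (Bstar i · ω) :=
      ae_all_iff.2 fun i ↦ (hBstar i).cont
    refine Filter.eventuallyEq_set.2 ?_
    filter_upwards [hc, hcs, hYae] with ω h1 h2 h3
    rw [mem_exceedance_iff_of_denseRange hq h2 h1, Set.mem_preimage, Set.mem_ofPred_eq,
      h3.1, h3.2]
  · filter_upwards [hYae] with ω h x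
    change exceedanceOn q (fun i n ↦ Y i n ω) (fun i n ↦ Y' i n ω) γ a x ↔ _
    rw [h.1, h.2]

lemma measurable_integrandC [IsFiniteMeasure P] {B Bstar : Fin 2 → ℝ≥0 → Ω → ℝ}
    (hB : ∀ i, IsBrownianReal (B i) P) (hBstar : ∀ i, IsBrownianReal (Bstar i) P)
    (γ : Fin 2 → ℝ) (a : ℝ) : Measurable (integrandC P Bstar B γ a) := by
  obtain ⟨E, hEm, hPE, -⟩ := exists_measurableSet_exceedance
    (TopologicalSpace.denseRange_denseSeq ℝ≥0) hB hBstar γ ![1, a]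
  have hint : integrandC P Bstar B γ a
      = fun x ↦ (P (Prod.mk x ⁻¹' E)).toReal * Real.exp (x 0 + a * x 1) := by
    ext x
    rw [integrandC, Measure.real, hPE]
  rw [hint]
  exact (measurable_measure_prodMk_left hEm).ennreal_toReal.mul (by fun_prop)

/-- The bound on `C(a)` in terms of lower integrals. By Tonelli's theorem the levels are integrated
out first for a fixed outcome; independence then splits the expectation into four factors, of which
the two belonging to `Bstar` are `2` each and the other two `2 / (2 - γ i)`. -/
lemma lintegral_integrandC_le [IsProbabilityMeasure P] {B Bstar : Fin 2 → ℝ≥0 → Ω → ℝ}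
    (hB : IsPlanarBrownian B P) (hBstar : IsPlanarBrownian Bstar P)
    (hindep : IndepFun (fun ω i t ↦ Bstar i t ω) (fun ω i t ↦ B i t ω) P)
    {γ : Fin 2 → ℝ} (hγ : ∀ i, 0 ≤ γ i ∧ γ i < 2) {a : ℝ} (ha : 0 < a) :
    ∫⁻ x, ENNReal.ofReal (integrandC P Bstar B γ a x)
      ≤ ENNReal.ofReal (16 / (a * (2 - γ 0) * (2 - γ 1))) := by
  have hpos : ∀ i, 0 < (![1, a] : Fin 2 → ℝ) i := by
    intro i; fin_cases i <;> simp [ha]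
  let q : ℕ → ℝ≥0 := TopologicalSpace.denseSeq ℝ≥0
  obtain ⟨E, hEm, hPE, hE⟩ := exists_measurableSet_exceedance
    (TopologicalSpace.denseRange_denseSeq ℝ≥0) hB.brownian hBstar.brownian γ ![1, a]
  have hX i := (hB.brownian i).toIsPreBrownianReal
  have hXs i := (hBstar.brownian i).toIsPreBrownianReal
  set e : (Fin 2 → ℝ) → ℝ≥0∞ := fun x ↦ ENNReal.ofReal (Real.exp (x 0 + a * x 1)) with he
  have hem : Measurable e := by fun_prop
  have h0 : 0 < 2 - γ 0 := by linarith [(hγ 0).2]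
  have h1 : 0 < 2 - γ 1 := by linarith [(hγ 1).2]
  calc ∫⁻ x, ENNReal.ofReal (integrandC P Bstar B γ a x)
      = ∫⁻ x, ∫⁻ ω, E.indicator (fun p ↦ e p.1) (x, ω) ∂P := by
        refine lintegral_congr fun x ↦ ?_
        rw [integrandC, Measure.real, hPE, ENNReal.ofReal_mul ENNReal.toReal_nonneg,
          ENNReal.ofReal_toReal (measure_ne_top _ _), mul_comm,
          ← lintegral_indicator_const (hEm.preimage measurable_prodMk_left)]
        rfl
    _ = ∫⁻ ω, (∫⁻ x, E.indicator (fun p ↦ e p.1) (x, ω)) ∂P :=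
        lintegral_lintegral_swap
          (((hem.comp measurable_fst).indicator hEm).aemeasurable)
    _ ≤ ∫⁻ ω, (expSup q 1 1 (fun t ↦ Bstar 0 t ω) * expSup q a a (fun t ↦ Bstar 1 t ω))
          * (expSup q (1 * γ 0) 1 (fun t ↦ B 0 t ω) * expSup q (a * γ 1) a (fun t ↦ B 1 t ω))
          / ENNReal.ofReal (1 * a) ∂P := by
        refine lintegral_mono_ae ?_
        filter_upwards [hE] with ω hω
        have hS : MeasurableSet ((fun x ↦ (x, ω)) ⁻¹' E) := hEm.preimage measurable_prodMk_right
        have := lintegral_exceedanceOn_le q (fun i t ↦ Bstar i t ω) (fun i t ↦ B i t ω) γ hpos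
        refine le_trans (le_of_eq ?_) this
        trans ∫⁻ x in (fun x ↦ (x, ω)) ⁻¹' E, e x
        · rw [← lintegral_indicator hS]
          rfl
        · have hset : (fun x ↦ (x, ω)) ⁻¹' E = {x : Fin 2 → ℝ | exceedanceOn q
              (fun i n ↦ Bstar i (q n) ω) (fun i n ↦ B i (q n) ω) γ ![1, a] x} := Set.ext hω
          rw [hset]
          simp [he]
    _ = (∫⁻ ω, expSup q 1 1 (fun t ↦ Bstar 0 t ω) * expSup q a a (fun t ↦ Bstar 1 t ω) ∂P)
          * (∫⁻ ω, expSup q (1 * γ 0) 1 (fun t ↦ B 0 t ω)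
              * expSup q (a * γ 1) a (fun t ↦ B 1 t ω) ∂P) / ENNReal.ofReal (1 * a) := by
        simp only [div_eq_mul_inv]
        rw [lintegral_mul_const' _ _ (by simp [ha])]
        congr 1
        refine lintegral_mul_eq_lintegral_mul_lintegral_of_indepFun''
          ((aemeasurable_expSup (hXs 0) q _ _).mul (aemeasurable_expSup (hXs 1) q _ _))
          ((aemeasurable_expSup (hX 0) q _ _).mul (aemeasurable_expSup (hX 1) q _ _)) ?_
        exact hindep.comp
          (φ := fun w : Fin 2 → ℝ≥0 → ℝ ↦ expSup q 1 1 (w 0) * expSup q a a (w 1))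
          (ψ := fun w : Fin 2 → ℝ≥0 → ℝ ↦
            expSup q (1 * γ 0) 1 (w 0) * expSup q (a * γ 1) a (w 1))
          (by fun_prop) (by fun_prop)
    _ ≤ (ENNReal.ofReal (2 * 1 / (2 * 1 - 1)) * ENNReal.ofReal (2 * a / (2 * a - a)))
          * (ENNReal.ofReal (2 * 1 / (2 * 1 - 1 * γ 0))
            * ENNReal.ofReal (2 * a / (2 * a - a * γ 1))) / ENNReal.ofReal (1 * a) := by
        gcongr
        · refine hBstar.lintegral_expSup_mul_le q (c := ![1, a]) (b := ![1, a])
            (fun i ↦ (hpos i).le) fun i ↦ by linarith [hpos i]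
        · refine hB.lintegral_expSup_mul_le q (c := fun i ↦ ![1, a] i * γ i) (b := ![1, a])
            (fun i ↦ mul_nonneg (hpos i).le (hγ i).1) fun i ↦ ?_
          nlinarith [hpos i, (hγ i).2]
    _ = ENNReal.ofReal (16 / (a * (2 - γ 0) * (2 - γ 1))) := by
        have h2 : 0 < 2 * a - a * γ 1 := by nlinarith
        have h3 : 0 < 2 * 1 - 1 * γ 0 := by linarith
        have h4 : 0 < 2 * a - a := by linarith
        rw [← ENNReal.ofReal_mul (by norm_num), ← ENNReal.ofReal_mul (by positivity),
          ← ENNReal.ofReal_mul (by positivity), ← ENNReal.ofReal_div_of_pos (by linarith)]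
        congr 1
        rw [show 2 * a - a * γ 1 = a * (2 - γ 1) by ring, show 2 * a - a = a by ring, one_mul,
          one_mul]
        field_simp
        norm_num

end BrownianRisk

theorem mainTheorem2 {Ω : Type*} [MeasurableSpace Ω] (P : Measure Ω) [IsProbabilityMeasure P]
    (B Bstar : Fin 2 → ℝ≥0 → Ω → ℝ)
    (hB : BrownianRisk.IsPlanarBrownian B P) (hBstar : BrownianRisk.IsPlanarBrownian Bstar P)
    (hindep : IndepFun (fun ω i t ↦ Bstar i t ω) (fun ω i t ↦ B i t ω) P)
    (γ : Fin 2 → ℝ) (hγ : ∀ i, 0 ≤ γ i ∧ γ i < 2) (a : ℝ) (ha : 0 < a) :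
    Integrable (BrownianRisk.integrandC P Bstar B γ a) ∧
      BrownianRisk.constC P Bstar B γ a ≤ 16 / (a * (2 - γ 0) * (2 - γ 1)) := by
  have hmeas := BrownianRisk.measurable_integrandC hB.brownian hBstar.brownian γ a
  have hbound := BrownianRisk.lintegral_integrandC_le hB hBstar hindep hγ ha
  have hnonneg : ∀ x, 0 ≤ BrownianRisk.integrandC P Bstar B γ a x := fun x ↦
    mul_nonneg measureReal_nonneg (Real.exp_nonneg _)
  refine ⟨⟨hmeas.aestronglyMeasurable, ?_⟩, ?_⟩
  · rw [hasFiniteIntegral_iff_ofReal (ae_of_all _ hnonneg)]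
    exact hbound.trans_lt ENNReal.ofReal_lt_top
  · rw [BrownianRisk.constC, integral_eq_lintegral_of_nonneg_ae (ae_of_all _ hnonneg)
      hmeas.aestronglyMeasurable]
    refine ENNReal.toReal_le_of_le_ofReal ?_ hbound
    have h0 : 0 < 2 - γ 0 := by linarith [(hγ 0).2]
    have h1 : 0 < 2 - γ 1 := by linarith [(hγ 1).2]
    positivity
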